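/- Regard $\{0,1\}^d$ as the vertex set of the hypercube graph, in which two points are adjacent iff they differ in exactly one coordinate, and let $\mathrm{dist}$ be its shortest-path distance. A function $g:\{0,1\}^d\to\mathbb{R}$ is Lipschitz if $|g(x)-g(y)|\le \mathrm{dist}(x,y)$ for all $x,y$. For a probability distribution $D$ on $\{0,1\}^d$, let $\ell_{0,D}(f,\mathcal{L}ip)=\min_{g\text{ Lipschitz}}\Pr_{x\sim D}[f(x)\neq g(x)]$. For $r>0$, a distribution-free Lipschitz $\frac12$-tester for functions $\{0,1\}^d\to[0,r]$ is a randomized, possibly adaptive algorithm $\mathcal{T}$ that, on an input consisting of a function $f:\{0,1\}^d\to[0,r]$ and a distribution $D$ on $\{0,1\}^d$, may query $f$ at points of its choice and draw independent samples from $D$, such that for every such $(f,D)$: if $f$ is Lipschitz, then $\mathcal{T}(f,D)$ accepts with probability at least $2/3$, and if $\ell_{0,D}(f,\mathcal{L}ip)\ge\frac12$, then $\mathcal{T}(f,D)$ rejects with probability at least $2/3$. The sample (respectively, query) complexity of $\mathcal{T}(f,D)$ is the maximum number in $\mathbb{N}\cup\{\infty\}$ of samples drawn (respectively, queries made) over all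 executions of $\mathcal{T}$ on $(f,D)$, up to an event of probability zero. Theorem. There exist absolute constants $c>0$ and $d_0\in\mathbb{N}$ such that for all integers $d\ge d_0$, all even integers $r$ with $4\le r\le 2^{-16}d$, and every distribution-free Lipschitz $\frac12$-tester $\mathcal{T}$ for functions $\{0,1\}^d\to[0,r]$, there exist a function $f:\{0,1\}^d\to[0,r]$ and a distribution $D$ on $\{0,1\}^d$ such that $\mathcal{T}(f,D)$ has sample complexity at least $2^{cd}$ or query complexity at least $(d/r)^{cr}$. -/

import Mathlib

open scoped ENNReal
open MeasureTheory

universe u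

namespace LipschitzTesting

/-- The vertex set `{0,1}^d`. -/
abbrev Cube (d : ℕ) : Type := Fin d → Bool

/-- The `d`-dimensional hypercube graph: two vertices are adjacent iff they differ in exactly one
coordinate. -/
def hypercube (d : ℕ) : SimpleGraph (Cube d) where
  Adj x y := hammingDist x y = 1
  symm := ⟨fun x y h => by rw [hammingDist_comm]; exact h⟩
  loopless := ⟨fun x h => by simp at h⟩

/-- `f` is Lipschitz with respect to the graph metric of the hypercube. -/
def IsLip {d : ℕ} (f : Cube d → ℝ) : Prop :=
  ∀ x y : Cube d, |f x - f y| ≤ ((hypercube d).dist x y : ℝ)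

/-- The `ℓ₀`-distance of `f` to the set of Lipschitz functions with respect to a distribution `D`:
the minimum over Lipschitz `g` of `Pr_{x ∼ D}[f x ≠ g x]`. -/
noncomputable def distToLip {d : ℕ} (D : PMF (Cube d)) (f : Cube d → ℝ) : ℝ≥0∞ :=
  ⨅ g : {g : Cube d → ℝ // IsLip g}, D.toMeasure {x | f x ≠ g.1 x}

/-- What an algorithm may do next: query the input function at a point, draw a fresh sample from
the input distribution, or halt with a verdict. -/
inductive Action (d : ℕ) : Type
  | query (x : Cube d)
  | sample
  | accept
  | reject

/-- What an algorithm gets back: the value at a queried point, or a sampled point. -/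
inductive Answer (d : ℕ) : Type
  | value (v : ℝ)
  | point (x : Cube d)

/-- Whether an answer is a sampled point. -/
def Answer.isPoint {d : ℕ} : Answer d → Bool
  | .value _ => false
  | .point _ => true

/-- The number of samples drawn in a transcript. -/
def numSamples {d : ℕ} (t : List (Answer d)) : ℕ := t.countP fun a => a.isPoint

/-- The number of queries made in a transcript. -/
def numQueries {d : ℕ} (t : List (Answer d)) : ℕ := t.countP fun a => !a.isPoint

/-- A randomized, adaptive algorithm with query access to a function on `{0,1}^d` and sample access
to a distribution on `{0,1}^d`. Its internal randomness is a seed from an arbitrary probability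
space; its next action is a function of the seed and of all answers received so far (which
determine its own earlier actions). There is no a priori bound on the length of a run. -/
structure Algorithm (d : ℕ) where
  /-- The set of random seeds. -/
  Seed : Type u
  /-- The events on seeds. -/
  [measurableSpace : MeasurableSpace Seed]
  /-- The distribution of the seed. -/
  seedLaw : Measure Seed
  /-- The seed is drawn from a probability distribution. -/
  [isProbabilityMeasure : IsProbabilityMeasure seedLaw]
  /-- The next action, given the seed and the answers so far. -/
  next : Seed → List (Answer d) → Action d
  /-- For every sequence of answers, the next action is a random variable. -/
  measurableSet_next : ∀ (t : List (Answer d)) (a : Action d), MeasurableSet {ρ | next ρ t = a}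

attribute [instance] Algorithm.measurableSpace Algorithm.isProbabilityMeasure

namespace Algorithm

variable {d : ℕ} (T : Algorithm.{u} d)

/-- The answers received during the first `n` steps of the run of `T` on the function `f`, when the
seed is `ρ` and the successive samples are `s 0, s 1, s 2, …`. Nothing changes after halting. -/
def transcript (f : Cube d → ℝ) (ρ : T.Seed) (s : ℕ → Cube d) : ℕ → List (Answer d)
  | 0 => []
  | n + 1 =>
    match T.next ρ (transcript f ρ s n) with
    | .query x => transcript f ρ s n ++ [.value (f x)]
    | .sample => transcript f ρ s n ++ [.point (s (numSamples (transcript f ρ s n)))]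
    | .accept => transcript f ρ s n
    | .reject => transcript f ρ s n

/-- The law of the seed together with an independent sequence of i.i.d. samples from `D`. -/
noncomputable def runLaw (D : PMF (Cube d)) : Measure (T.Seed × (ℕ → Cube d)) :=
  T.seedLaw.prod (Measure.infinitePi fun _ : ℕ => D.toMeasure)

/-- The probability that `T` halts and accepts on input `(f, D)`. -/
noncomputable def acceptProb (f : Cube d → ℝ) (D : PMF (Cube d)) : ℝ≥0∞ :=
  T.runLaw D {p | ∃ n, T.next p.1 (T.transcript f p.1 p.2 n) = .accept}

/-- The probability that `T` halts and rejects on input `(f, D)`. -/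
noncomputable def rejectProb (f : Cube d → ℝ) (D : PMF (Cube d)) : ℝ≥0∞ :=
  T.runLaw D {p | ∃ n, T.next p.1 (T.transcript f p.1 p.2 n) = .reject}

/-- The sample complexity of `T` on input `(f, D)`: the worst case, over all executions up to an
event of probability zero, of the total number of samples drawn (possibly infinite). -/
noncomputable def sampleComplexity (f : Cube d → ℝ) (D : PMF (Cube d)) : ℕ∞ :=
  essSup (fun p => ⨆ n, (numSamples (T.transcript f p.1 p.2 n) : ℕ∞)) (T.runLaw D)

/-- The query complexity of `T` on input `(f, D)`: the worst case, over all executions up to an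
event of probability zero, of the total number of queries made (possibly infinite). -/
noncomputable def queryComplexity (f : Cube d → ℝ) (D : PMF (Cube d)) : ℕ∞ :=
  essSup (fun p => ⨆ n, (numQueries (T.transcript f p.1 p.2 n) : ℕ∞)) (T.runLaw D)

/-- `T` is a distribution-free Lipschitz `ε`-tester for functions `{0,1}^d → [0,r]`. -/
def IsDistributionFreeLipTester (r : ℝ) (ε : ℝ≥0∞) : Prop :=
  ∀ (f : Cube d → ℝ) (D : PMF (Cube d)), (∀ x, f x ∈ Set.Icc 0 r) →
    (IsLip f → 2 / 3 ≤ T.acceptProb f D) ∧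
    (ε ≤ distToLip D f → 2 / 3 ≤ T.rejectProb f D)

end Algorithm

end LipschitzTesting

/-!
Split the cube as `{0,1}^m × {0,1}^n` and take the copies of `{0,1}^n` over a code of minimum
distance `r = 2h` in `{0,1}^m` as disjoint cells. In each cell `c` put a low apex, of value `0`, at
a uniformly random `u c` and a high apex, of value `r`, at `u c` flipped on a random set `Y` common
to all cells; around them interpolate to the constant `h` by cones of slope `1`. If `#Y = r`, the
function is Lipschitz. If `#Y = r - 1`, the two apexes of a cell violate the Lipschitz condition,
and since the distribution is uniform on the apexes, half of its mass has to be changed.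

A tester drawing few samples sees, except with small probability, at most one apex per cell. The
positions of the seen apexes are uniform and independent whatever `Y` is, so they say nothing about
`Y`; the hidden apexes are the seen ones flipped on `Y`, so a query chosen without knowledge of `Y`
is unlikely to come close to one. Hence the runs for `#Y = r` and for `#Y = r - 1` are both close
to the runs on a function with the seen cones only, which does not depend on `Y`, and they cannot
accept and reject, respectively, with probability `2/3` each.
-/

open scoped Finset

namespace LipschitzTesting

/-! ### The Hamming metric -/

section HammingDist

variable {ι : Type*} [Fintype ι] [DecidableEq ι] {β : ι → Type*} [∀ i, DecidableEq (β i)]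

theorem hammingDist_update_self {x : ∀ i, β i} {i : ι} {b : β i} (hb : x i ≠ b) :
    hammingDist x (Function.update x i b) = 1 := by
  refine Finset.card_eq_one.2 ⟨i, Finset.ext fun j => ?_⟩
  by_cases hj : j = i
  · subst hj
    simpa using hb
  · simp [hj]

theorem hammingDist_update_add_one {x y : ∀ i, β i} {i : ι} (hi : x i ≠ y i) :
    hammingDist (Function.update x i (y i)) y + 1 = hammingDist x y := by
  have key : ({j | Function.update x i (y i) j ≠ y j} : Finset ι) =
      ({j | x j ≠ y j} : Finset ι).erase i := by
    ext j
    by_cases hj : j = i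
    · subst hj
      simp
    · simp [hj]
  unfold hammingDist
  rw [key, Finset.card_erase_add_one (by simpa using hi)]

end HammingDist

theorem hammingDist_append {m n : ℕ} {α : Type*} [DecidableEq α] (x x' : Fin m → α)
    (y y' : Fin n → α) :
    hammingDist (Fin.append x y) (Fin.append x' y') = hammingDist x x' + hammingDist y y' := by
  simp only [hammingDist, Finset.card_filter, Fin.sum_univ_add, Fin.append_left, Fin.append_right]

theorem hammingDist_le_walk_length {d : ℕ} {x y : Cube d} (w : (hypercube d).Walk x y) :
    hammingDist x y ≤ w.length := by
  induction w with
  | nil => simp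
  | @cons a b c hab w ih =>
    have hab' : hammingDist a b = 1 := hab
    calc hammingDist a c ≤ hammingDist a b + hammingDist b c := hammingDist_triangle a b c
      _ ≤ w.length + 1 := by omega

theorem exists_walk_length_eq_hammingDist {d : ℕ} (x y : Cube d) :
    ∃ w : (hypercube d).Walk x y, w.length = hammingDist x y := by
  induction hn : hammingDist x y generalizing x with
  | zero =>
    obtain rfl := hammingDist_eq_zero.1 hn
    exact ⟨.nil, rfl⟩
  | succ n ih =>
    obtain ⟨i, hi⟩ := Function.ne_iff.1 (hammingDist_ne_zero.1 (by omega : hammingDist x y ≠ 0))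
    have hadj : (hypercube d).Adj x (Function.update x i (y i)) := hammingDist_update_self hi
    obtain ⟨w, hw⟩ := ih (Function.update x i (y i)) (by
      have := hammingDist_update_add_one hi
      omega)
    exact ⟨.cons hadj w, by simp [hw]⟩

theorem hypercube_dist {d : ℕ} (x y : Cube d) : (hypercube d).dist x y = hammingDist x y := by
  obtain ⟨w, hw⟩ := exists_walk_length_eq_hammingDist x y
  obtain ⟨w', hw'⟩ := w.reachable.exists_walk_length_eq_dist
  exact le_antisymm (hw ▸ SimpleGraph.dist_le w) (hw' ▸ hammingDist_le_walk_length w')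

/-! ### Hamming balls and codes -/

/-- The number of points in a Hamming ball of radius `m` in `ι → Bool`, encoded as the number of
sets of at most `m` coordinates at which a point of the ball may differ from the centre. -/
def hammingBallCard (ι : Type*) [Fintype ι] (m : ℕ) : ℕ := #{Y : Finset ι | #Y ≤ m}

theorem hammingBallCard_mul_pow_le {ι : Type*} [Fintype ι] (m : ℕ) {x : ℝ} (hx : 0 ≤ x)
    (hx1 : x ≤ 1) :
    hammingBallCard ι m * x ^ m ≤ (1 + x) ^ Fintype.card ι := by
  calc hammingBallCard ι m * x ^ m
      ≤ ∑ Y : Finset ι with #Y ≤ m, x ^ #Y := by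
        rw [hammingBallCard, ← nsmul_eq_mul]
        exact Finset.card_nsmul_le_sum _ _ _ fun Y hY =>
          pow_le_pow_of_le_one hx hx1 (Finset.mem_filter.1 hY).2
    _ ≤ ∑ Y : Finset ι, x ^ #Y := Finset.sum_le_univ_sum_of_nonneg fun Y => pow_nonneg hx _
    _ = (1 + x) ^ Fintype.card ι := by
        simpa [add_comm] using Finset.sum_pow_mul_eq_add_pow x 1 (Finset.univ : Finset ι)

section Flip

variable {ι : Type*} [DecidableEq ι]

/-- The point obtained from `x` by flipping the coordinates in `Y`. -/
def flipOn (x : ι → Bool) (Y : Finset ι) : ι → Bool := fun i => xor (x i) (decide (i ∈ Y))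

theorem flipOn_flipOn (x : ι → Bool) (Y : Finset ι) : flipOn (flipOn x Y) Y = x := by
  funext i
  simp [flipOn]

theorem flipOn_injective (x : ι → Bool) : Function.Injective (flipOn x) := fun Y Z hYZ =>
  Finset.ext fun i => by simpa [flipOn] using congrFun hYZ i

variable [Fintype ι]

theorem flipOn_filter_ne (x z : ι → Bool) : flipOn x {i | x i ≠ z i} = z := by
  funext i
  cases hx : x i <;> cases hz : z i <;> simp [flipOn, hx, hz]

theorem hammingDist_flipOn (x : ι → Bool) (Y : Finset ι) : hammingDist x (flipOn x Y) = #Y := by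
  unfold hammingDist
  congr 1
  ext i
  rw [Finset.mem_filter]
  by_cases hi : i ∈ Y <;> simp [flipOn, hi]

theorem card_hammingDist_le (x : ι → Bool) (m : ℕ) :
    #{z | hammingDist x z ≤ m} ≤ hammingBallCard ι m := by
  refine Finset.card_le_card_of_surjOn (flipOn x) fun z hz => ⟨_, ?_, flipOn_filter_ne x z⟩
  simpa [hammingDist] using hz

theorem card_hammingDist_flipOn_le (s : Finset (Finset ι)) (x v : ι → Bool) (m : ℕ) :
    #{Y ∈ s | hammingDist x (flipOn v Y) ≤ m} ≤ hammingBallCard ι m := by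
  refine (Finset.card_le_card_of_injOn (flipOn v) ?_ (flipOn_injective v).injOn).trans
    (card_hammingDist_le x m)
  intro Y hY
  simpa using (Finset.mem_filter.1 hY).2

end Flip

theorem exists_pairwise_forall_notMem_exists_not {α : Type*} [Finite α] {R : α → α → Prop}
    (hR : ∀ x y, R x y → R y x) :
    ∃ C : Finset α, (C : Set α).Pairwise R ∧ ∀ z ∉ C, ∃ x ∈ C, ¬ R x z := by
  classical
  obtain ⟨C, hC, hmax⟩ := (Set.toFinite {C : Finset α | (C : Set α).Pairwise R}).exists_maximal
    ⟨∅, by simp⟩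
  refine ⟨C, hC, fun z hz => ?_⟩
  by_contra! hfar
  have hinsert : ((insert z C : Finset α) : Set α).Pairwise R := by
    rw [Finset.coe_insert, Set.pairwise_insert]
    exact ⟨hC, fun x hx _ => ⟨hR _ _ (hfar x hx), hfar x hx⟩⟩
  exact hz (hmax hinsert (Finset.subset_insert z C) (Finset.mem_insert_self z C))

/-- The **Gilbert–Varshamov bound**. -/
theorem exists_code (ι : Type*) [Fintype ι] (r : ℕ) :
    ∃ C : Finset (ι → Bool), (C : Set (ι → Bool)).Pairwise (fun x y => r ≤ hammingDist x y) ∧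
      2 ^ Fintype.card ι ≤ #C * hammingBallCard ι (r - 1) := by
  classical
  obtain ⟨C, hC, hmax⟩ := exists_pairwise_forall_notMem_exists_not
    (R := fun x y : ι → Bool => r ≤ hammingDist x y) fun x y h => hammingDist_comm x y ▸ h
  refine ⟨C, hC, ?_⟩
  have hcover : Finset.univ ⊆ C.biUnion fun x => {z | hammingDist x z ≤ r - 1} := by
    intro z _
    by_cases hz : z ∈ C
    · exact Finset.mem_biUnion.2 ⟨z, hz, by simp⟩
    · obtain ⟨x, hx, hxz⟩ := hmax z hz
      exact Finset.mem_biUnion.2 ⟨x, hx, by simpa using by omega⟩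
  calc 2 ^ Fintype.card ι = #(Finset.univ : Finset (ι → Bool)) := by simp
    _ ≤ #(C.biUnion fun x => {z | hammingDist x z ≤ r - 1}) := Finset.card_le_card hcover
    _ ≤ #C * hammingBallCard ι (r - 1) :=
        Finset.card_biUnion_le_card_mul _ _ _ fun x _ => card_hammingDist_le x _

/-! ### Functions with conical dents and bumps -/

section Cones

variable {ι : Type*} [Fintype ι] {β : ι → Type*} [∀ i, DecidableEq (β i)] {C : Type*}
  {h : ℕ} {a b : C → ∀ i, β i} {S L H : Finset C}

/-- The upper envelope of the cones of height `h` and slope `1` with apexes `a c`, for `c ∈ S`. -/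
def bump (h : ℕ) (a : C → ∀ i, β i) (S : Finset C) (z : ∀ i, β i) : ℕ :=
  S.sup fun c => h - hammingDist z (a c)

theorem bump_le (z : ∀ i, β i) : bump h a S z ≤ h :=
  Finset.sup_le fun _ _ => Nat.sub_le _ _

theorem bump_apex {c : C} (hc : c ∈ S) : bump h a S (a c) = h := by
  refine le_antisymm (bump_le _) ?_
  calc h = h - hammingDist (a c) (a c) := by simp
    _ ≤ bump h a S (a c) := Finset.le_sup (f := fun c' => h - hammingDist (a c) (a c')) hc

theorem bump_eq_zero {z : ∀ i, β i} (hz : ∀ c ∈ S, h ≤ hammingDist z (a c)) :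
    bump h a S z = 0 :=
  Nat.le_zero.1 (Finset.sup_le fun c hc => (Nat.sub_eq_zero_of_le (hz c hc)).le)

theorem bump_filter_eq {p : C → Prop} [DecidablePred p] {z : ∀ i, β i}
    (hz : ∀ c ∈ S, ¬ p c → h ≤ hammingDist z (a c)) :
    bump h a (S.filter p) z = bump h a S z := by
  refine le_antisymm (Finset.sup_mono (Finset.filter_subset p S)) (Finset.sup_le fun c hc => ?_)
  by_cases hpc : p c
  · exact Finset.le_sup (f := fun c => h - hammingDist z (a c)) (Finset.mem_filter.2 ⟨hc, hpc⟩)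
  · simp [Nat.sub_eq_zero_of_le (hz c hc hpc)]

theorem bump_congr {a' : C → ∀ i, β i} (ha : ∀ c ∈ S, a c = a' c) (z : ∀ i, β i) :
    bump h a S z = bump h a' S z :=
  Finset.sup_congr rfl fun c hc => by rw [ha c hc]

theorem bump_le_bump_add_hammingDist (z z' : ∀ i, β i) :
    bump h a S z ≤ bump h a S z' + hammingDist z z' := by
  refine Finset.sup_le fun c hc => ?_
  have hle : h - hammingDist z' (a c) ≤ bump h a S z' :=
    Finset.le_sup (f := fun c => h - hammingDist z' (a c)) hc
  have htri := hammingDist_triangle_left z' (a c) z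
  omega

theorem exists_bump_add_hammingDist_eq {z : ∀ i, β i} (hz : 0 < bump h a S z) :
    ∃ c ∈ S, bump h a S z + hammingDist z (a c) = h := by
  have hS : S.Nonempty := Finset.nonempty_iff_ne_empty.2 fun hS => by simp [hS, bump] at hz
  obtain ⟨c, hc, hsup⟩ := Finset.exists_mem_eq_sup S hS fun c => h - hammingDist z (a c)
  exact ⟨c, hc, by simp only [bump] at hz ⊢; omega⟩

/-- The function of constant value `h`, with downward cones of depth `h` at the apexes `a c`,
`c ∈ L`, and upward cones of height `h` at the apexes `b c`, `c ∈ H`. -/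
noncomputable def coneFn (h : ℕ) (a b : C → ∀ i, β i) (L H : Finset C) (z : ∀ i, β i) : ℝ :=
  h - bump h a L z + bump h b H z

theorem coneFn_mem_Icc (z : ∀ i, β i) : coneFn h a b L H z ∈ Set.Icc 0 ((2 * h : ℕ) : ℝ) := by
  have hlow : (bump h a L z : ℝ) ≤ h := mod_cast bump_le z
  have hhigh : (bump h b H z : ℝ) ≤ h := mod_cast bump_le z
  simp only [coneFn, Set.mem_Icc, Nat.cast_mul, Nat.cast_ofNat]
  constructor <;> linarith [Nat.cast_nonneg (α := ℝ) (bump h a L z),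
    Nat.cast_nonneg (α := ℝ) (bump h b H z)]

theorem coneFn_low_apex {c : C} (hc : c ∈ L) (hH : ∀ c' ∈ H, h ≤ hammingDist (a c) (b c')) :
    coneFn h a b L H (a c) = 0 := by
  simp [coneFn, bump_apex hc, bump_eq_zero hH]

theorem coneFn_high_apex {c : C} (hc : c ∈ H) (hL : ∀ c' ∈ L, h ≤ hammingDist (b c) (a c')) :
    coneFn h a b L H (b c) = 2 * h := by
  rw [coneFn, bump_apex hc, bump_eq_zero hL, Nat.cast_zero]
  ring

theorem coneFn_le_coneFn_add_hammingDist
    (hab : ∀ c ∈ L, ∀ c' ∈ H, 2 * h ≤ hammingDist (a c) (b c')) (z z' : ∀ i, β i) :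
    coneFn h a b L H z' ≤ coneFn h a b L H z + hammingDist z z' := by
  have key : bump h a L z + bump h b H z' ≤
      bump h a L z' + bump h b H z + hammingDist z z' := by
    have hlow := bump_le_bump_add_hammingDist (h := h) (a := a) (S := L) z z'
    have hhigh := bump_le_bump_add_hammingDist (h := h) (a := b) (S := H) z' z
    rw [hammingDist_comm z' z] at hhigh
    rcases Nat.eq_zero_or_pos (bump h a L z) with hz | hz
    · omega
    rcases Nat.eq_zero_or_pos (bump h b H z') with hz' | hz'
    · omega
    obtain ⟨c, hc, hceq⟩ := exists_bump_add_hammingDist_eq hz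
    obtain ⟨c', hc', hceq'⟩ := exists_bump_add_hammingDist_eq hz'
    have := hab c hc c' hc'
    have := hammingDist_triangle_left (a c) (b c') z
    have := hammingDist_triangle z z' (b c')
    omega
  have key' : (bump h a L z : ℝ) + bump h b H z' ≤
      bump h a L z' + bump h b H z + hammingDist z z' := mod_cast key
  simp only [coneFn]
  linarith

theorem isLip_coneFn {d : ℕ} {a b : C → Cube d}
    (hab : ∀ c ∈ L, ∀ c' ∈ H, 2 * h ≤ hammingDist (a c) (b c')) :
    IsLip (coneFn h a b L H) := by
  intro x y
  rw [hypercube_dist, abs_sub_le_iff, sub_le_iff_le_add', sub_le_iff_le_add']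
  exact ⟨hammingDist_comm y x ▸ coneFn_le_coneFn_add_hammingDist hab y x,
    coneFn_le_coneFn_add_hammingDist hab x y⟩

end Cones

/-! ### Runs of an algorithm -/

theorem measurableSet_mem_of_countable_range {Ω γ : Type*} [MeasurableSpace Ω] {X : Ω → γ}
    (hX : (Set.range X).Countable) (hfib : ∀ t, MeasurableSet {ω | X ω = t}) {B : γ → Set Ω}
    (hB : ∀ t, MeasurableSet (B t)) : MeasurableSet {ω | ω ∈ B (X ω)} := by
  have key : {ω | ω ∈ B (X ω)} = ⋃ t ∈ Set.range X, {ω | X ω = t} ∩ B t := by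
    ext ω
    simp only [Set.mem_ofPred_eq, Set.mem_iUnion, Set.mem_inter_iff, Set.mem_range, exists_prop]
    exact ⟨fun hω => ⟨_, ⟨ω, rfl⟩, rfl, hω⟩, fun ⟨_, _, ht, hω⟩ => ht ▸ hω⟩
  rw [key]
  exact MeasurableSet.biUnion hX fun t _ => (hfib t).inter (hB t)

theorem ae_forall_le_floor_of_essSup_lt {α : Type*} [MeasurableSpace α] {μ : Measure α}
    {N : ℕ → α → ℕ} {x : ℝ}
    (hx : ((essSup (fun p => ⨆ n, (N n p : ℕ∞)) μ : ℕ∞) : ℝ≥0∞) < ENNReal.ofReal x) :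
    ∀ᵐ p ∂μ, ∀ n, N n p ≤ ⌊x⌋₊ := by
  have hfloor : ENNReal.ofReal x ≤ ((⌊x⌋₊ + 1 : ℕ) : ℕ∞) := by
    rw [ENat.toENNReal_coe, ← ENNReal.ofReal_natCast]
    exact ENNReal.ofReal_le_ofReal (mod_cast (Nat.lt_floor_add_one x).le)
  filter_upwards [ae_lt_of_essSup_lt (ENat.toENNReal_lt.1 (hx.trans_le hfloor))] with p hp n
  have hn := (le_iSup (fun n => (N n p : ℕ∞)) n).trans_lt hp
  exact Nat.lt_succ_iff.1 (mod_cast hn)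

instance {d : ℕ} : Finite (Action d) := by
  refine Set.finite_univ_iff.1 (((Set.finite_range Action.query).union
    (Set.toFinite {.sample, .accept, .reject})).subset ?_)
  rintro (x | _ | _ | _) - <;> simp

namespace Algorithm

variable {d : ℕ} (T : Algorithm.{u} d) {f f' : Cube d → ℝ} {ρ : T.Seed} {s s' : ℕ → Cube d}
  {M Q : ℕ}

/-- The transcript `t` extended by the answer, if any, to the action `a`, when the input function
is `f` and the successive samples are `s 0, s 1, s 2, …`. -/
def extend (f : Cube d → ℝ) (s : ℕ → Cube d) (t : List (Answer d)) : Action d → List (Answer d)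
  | .query x => t ++ [.value (f x)]
  | .sample => t ++ [.point (s (numSamples t))]
  | .accept => t
  | .reject => t

theorem transcript_succ (f : Cube d → ℝ) (ρ : T.Seed) (s : ℕ → Cube d) (n : ℕ) :
    T.transcript f ρ s (n + 1) =
      extend f s (T.transcript f ρ s n) (T.next ρ (T.transcript f ρ s n)) := by
  rw [transcript]
  cases T.next ρ (T.transcript f ρ s n) <;> rfl

/-- The run of `T` on `f`, with seed `ρ` and samples `s`, takes the action `a` at some step. For a
verdict `a` this means that the run halts with verdict `a`. -/
def Takes (f : Cube d → ℝ) (ρ : T.Seed) (s : ℕ → Cube d) (a : Action d) : Prop :=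
  ∃ n, T.next ρ (T.transcript f ρ s n) = a

/-- The run of `T` on `f`, with seed `ρ` and samples `s`, draws at most `M` samples and makes at
most `Q` queries. -/
def UsesAtMost (f : Cube d → ℝ) (ρ : T.Seed) (s : ℕ → Cube d) (M Q : ℕ) : Prop :=
  ∀ n, numSamples (T.transcript f ρ s n) ≤ M ∧ numQueries (T.transcript f ρ s n) ≤ Q

theorem le_sampleComplexity_or_le_queryComplexity {D : PMF (Cube d)} {x y : ℝ}
    (hxy : ¬ ∀ᵐ p ∂T.runLaw D, T.UsesAtMost f p.1 p.2 ⌊x⌋₊ ⌊y⌋₊) :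
    ENNReal.ofReal x ≤ T.sampleComplexity f D ∨ ENNReal.ofReal y ≤ T.queryComplexity f D := by
  contrapose! hxy
  filter_upwards [ae_forall_le_floor_of_essSup_lt hxy.1, ae_forall_le_floor_of_essSup_lt hxy.2]
    with p hM hQ n
  exact ⟨hM n, hQ n⟩

section Verdicts

theorem transcript_eq_of_halt {n m : ℕ}
    (hn : T.next ρ (T.transcript f ρ s n) = .accept ∨ T.next ρ (T.transcript f ρ s n) = .reject)
    (hnm : n ≤ m) : T.transcript f ρ s m = T.transcript f ρ s n := by
  induction m, hnm using Nat.le_induction with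
  | base => rfl
  | succ m _ ih =>
    rw [transcript_succ, ih]
    rcases hn with hn | hn <;> rw [hn] <;> rfl

theorem not_takes_accept_and_reject :
    ¬ (T.Takes f ρ s .accept ∧ T.Takes f ρ s .reject) := by
  rintro ⟨⟨n, hn⟩, m, hm⟩
  rcases le_total n m with hnm | hmn
  · rw [T.transcript_eq_of_halt (.inl hn) hnm, hn] at hm
    exact nomatch hm
  · rw [T.transcript_eq_of_halt (.inr hm) hmn, hm] at hn
    exact nomatch hn

end Verdicts

section Queries

theorem numQueries_le_numQueries_extend (t : List (Answer d)) (a : Action d) :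
    numQueries t ≤ numQueries (extend f s t a) := by
  cases a <;> simp [extend, numQueries]

theorem monotone_numQueries : Monotone fun n => numQueries (T.transcript f ρ s n) :=
  monotone_nat_of_le_succ fun n => by
    rw [transcript_succ]
    exact numQueries_le_numQueries_extend _ _

theorem numQueries_succ_of_query {n : ℕ} {z : Cube d}
    (hn : T.next ρ (T.transcript f ρ s n) = .query z) :
    numQueries (T.transcript f ρ s (n + 1)) = numQueries (T.transcript f ρ s n) + 1 := by
  rw [transcript_succ, hn]
  simp [extend, numQueries, Answer.isPoint]

theorem numSamples_succ_of_sample {n : ℕ} (hn : T.next ρ (T.transcript f ρ s n) = .sample) :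
    numSamples (T.transcript f ρ s (n + 1)) = numSamples (T.transcript f ρ s n) + 1 := by
  rw [transcript_succ, hn]
  simp [extend, numSamples, Answer.isPoint]

theorem query_eq_of_numQueries_eq {n m : ℕ} {x y : Cube d}
    (hn : T.next ρ (T.transcript f ρ s n) = .query x)
    (hm : T.next ρ (T.transcript f ρ s m) = .query y)
    (hnm : numQueries (T.transcript f ρ s n) = numQueries (T.transcript f ρ s m)) : x = y := by
  wlog hle : n ≤ m generalizing n m x y
  · exact (this hm hn hnm.symm (by omega)).symm
  rcases hle.eq_or_lt with rfl | hlt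
  · simpa [hn] using hm
  · have hmono : numQueries (T.transcript f ρ s (n + 1)) ≤ numQueries (T.transcript f ρ s m) :=
      T.monotone_numQueries hlt
    rw [T.numQueries_succ_of_query hn] at hmono
    omega

open Classical in
/-- The points of the first `Q` queries of the run of `T` on `f` with seed `ρ` and samples `s`. -/
noncomputable def firstQueries (f : Cube d → ℝ) (ρ : T.Seed) (s : ℕ → Cube d) (Q : ℕ) :
    Finset (Cube d) :=
  {z | ∃ n, numQueries (T.transcript f ρ s n) < Q ∧ T.next ρ (T.transcript f ρ s n) = .query z}

theorem mem_firstQueries {z : Cube d} : z ∈ T.firstQueries f ρ s Q ↔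
    ∃ n, numQueries (T.transcript f ρ s n) < Q ∧ T.next ρ (T.transcript f ρ s n) = .query z := by
  simp [firstQueries]

theorem card_firstQueries_le (f : Cube d → ℝ) (ρ : T.Seed) (s : ℕ → Cube d) (Q : ℕ) :
    #(T.firstQueries f ρ s Q) ≤ Q := by
  refine (Finset.card_le_card_of_forall_subsingleton (t := Finset.range Q)
    (fun z k => ∃ n, numQueries (T.transcript f ρ s n) = k ∧
      T.next ρ (T.transcript f ρ s n) = .query z) (fun z hz => ?_) fun k _ => ?_).trans
    (Finset.card_range Q).le
  · obtain ⟨n, hn, hz⟩ := T.mem_firstQueries.1 hz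
    exact ⟨_, Finset.mem_range.2 hn, n, rfl, hz⟩
  · rintro x ⟨_, n, hn, hx⟩ y ⟨_, m, hm, hy⟩
    exact T.query_eq_of_numQueries_eq hx hy (hn.trans hm.symm)

theorem transcript_eq_of_agree (hle : T.UsesAtMost f ρ s M Q) (hs : ∀ j < M, s j = s' j)
    (hf : ∀ z ∈ T.firstQueries f' ρ s' Q, f z = f' z) (n : ℕ) :
    T.transcript f ρ s n = T.transcript f' ρ s' n := by
  induction n with
  | zero => rfl
  | succ n ih =>
    obtain ⟨hM, hQ⟩ := hle (n + 1)
    rw [transcript_succ, transcript_succ, ← ih]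
    cases ha : T.next ρ (T.transcript f ρ s n) with
    | query z =>
      rw [T.numQueries_succ_of_query ha] at hQ
      have hz : z ∈ T.firstQueries f' ρ s' Q := T.mem_firstQueries.2 ⟨n, ih ▸ hQ, ih ▸ ha⟩
      simp only [extend, hf z hz]
    | sample =>
      rw [T.numSamples_succ_of_sample ha] at hM
      simp only [extend, hs _ hM]
    | accept => rfl
    | reject => rfl

theorem Takes.of_agree {a : Action d} (ha : T.Takes f ρ s a) (hle : T.UsesAtMost f ρ s M Q)
    (hs : ∀ j < M, s j = s' j) (hf : ∀ z ∈ T.firstQueries f' ρ s' Q, f z = f' z) :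
    T.Takes f' ρ s' a :=
  ha.imp fun n hn => T.transcript_eq_of_agree hle hs hf n ▸ hn

end Queries

section Measurability

theorem countable_range_transcript (f : Cube d → ℝ) (n : ℕ) :
    (Set.range fun p : T.Seed × (ℕ → Cube d) => T.transcript f p.1 p.2 n).Countable := by
  let answers : Set (Answer d) := Set.range (fun x => .value (f x)) ∪ Set.range .point
  have hanswers : {t : List (Answer d) | ∀ a ∈ t, a ∈ answers}.Countable := by
    have : Countable answers := (Set.toFinite answers).countable
    rw [← Set.range_list_map_coe]
    exact Set.countable_range _
  refine hanswers.mono ?_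
  rintro _ ⟨⟨ρ, s⟩, rfl⟩
  induction n with
  | zero => simp [transcript]
  | succ n ih =>
    simp only [transcript_succ]
    cases T.next ρ (T.transcript f ρ s n) with
    | query x | sample =>
      simp only [extend, Set.mem_ofPred_eq, List.mem_append, List.mem_singleton]
      rintro a (ha | rfl)
      · exact ih a ha
      · simp [answers]
    | accept | reject => exact ih

theorem measurableSet_extend (f : Cube d → ℝ) (t t' : List (Answer d)) (a : Action d) :
    MeasurableSet {s : ℕ → Cube d | extend f s t a = t'} := by
  cases a with
  | sample =>
    have hfin : MeasurableSet {x : Cube d | t ++ [.point x] = t'} := (Set.toFinite _).measurableSet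
    exact hfin.preimage (measurable_pi_apply (numSamples t))
  | _ => simp only [extend, MeasurableSet.const]

theorem measurableSet_transcript (f : Cube d → ℝ) (n : ℕ) (t : List (Answer d)) :
    MeasurableSet {p : T.Seed × (ℕ → Cube d) | T.transcript f p.1 p.2 n = t} := by
  induction n generalizing t with
  | zero => simp only [transcript, MeasurableSet.const]
  | succ n ih =>
    have hextend (t' : List (Answer d)) : MeasurableSet
        {p : T.Seed × (ℕ → Cube d) | extend f p.2 t' (T.next p.1 t') = t} :=
      measurableSet_mem_of_countable_range
        (X := fun p : T.Seed × (ℕ → Cube d) => T.next p.1 t')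
        (B := fun a => {p : T.Seed × (ℕ → Cube d) | extend f p.2 t' a = t}) (Set.to_countable _)
        (fun a => (T.measurableSet_next t' a).preimage measurable_fst)
        fun a => (measurableSet_extend f t' t a).preimage measurable_snd
    simp only [transcript_succ]
    exact measurableSet_mem_of_countable_range (T.countable_range_transcript f n) ih hextend

theorem measurableSet_takes (f : Cube d → ℝ) (a : Action d) :
    MeasurableSet {p : T.Seed × (ℕ → Cube d) | T.Takes f p.1 p.2 a} := by
  simp only [Takes, Set.ofPred_exists]
  exact MeasurableSet.iUnion fun n => measurableSet_mem_of_countable_range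
    (B := fun t => {p : T.Seed × (ℕ → Cube d) | T.next p.1 t = a})
    (T.countable_range_transcript f n) (T.measurableSet_transcript f n)
    fun t => (T.measurableSet_next t a).preimage measurable_fst

end Measurability

section Indices

variable {I : Type*} [MeasurableSpace I]

/-- The law of the seed together with an independent sequence of i.i.d. indices with law `μ`. It
drives the runs on all the images of `μ` at once. -/
noncomputable def indexLaw (μ : PMF I) : Measure (T.Seed × (ℕ → I)) :=
  T.seedLaw.prod (Measure.infinitePi fun _ : ℕ => μ.toMeasure)

instance (μ : PMF I) : IsProbabilityMeasure (T.indexLaw μ) := by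
  unfold indexLaw
  infer_instance

variable [DiscreteMeasurableSpace I]

theorem measurable_map_samples (g : I → Cube d) :
    Measurable (Prod.map id (g ∘ ·) : T.Seed × (ℕ → I) → T.Seed × (ℕ → Cube d)) :=
  measurable_id.prodMap (measurable_pi_lambda _ fun j =>
    (Measurable.of_discrete (f := g)).comp (measurable_pi_apply j))

theorem runLaw_map (μ : PMF I) (g : I → Cube d) :
    T.runLaw (μ.map g) = (T.indexLaw μ).map (Prod.map id (g ∘ ·)) := by
  have hg : Measurable g := .of_discrete
  have hsamples : Measurable fun ω : ℕ → I => g ∘ ω :=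
    measurable_pi_lambda _ fun j => hg.comp (measurable_pi_apply j)
  have hmap : Measure.infinitePi (fun _ : ℕ => (μ.map g).toMeasure) =
      (Measure.infinitePi fun _ : ℕ => μ.toMeasure).map (g ∘ ·) := by
    rw [← PMF.toMeasure_map g μ hg]
    exact (Measure.infinitePi_map_pi (μ := fun _ : ℕ => μ.toMeasure) (f := fun _ => g)
      fun _ => hg).symm
  rw [runLaw, indexLaw, ← Measure.map_prod_map _ _ measurable_id hsamples, Measure.map_id, hmap]

theorem measurableSet_takes_comp (f : Cube d → ℝ) (g : I → Cube d) (a : Action d) :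
    MeasurableSet {p : T.Seed × (ℕ → I) | T.Takes f p.1 (g ∘ p.2) a} :=
  (T.measurableSet_takes f a).preimage (T.measurable_map_samples g)

theorem runLaw_map_takes (f : Cube d → ℝ) (μ : PMF I) (g : I → Cube d) (a : Action d) :
    T.runLaw (μ.map g) {p | T.Takes f p.1 p.2 a} =
      T.indexLaw μ {p | T.Takes f p.1 (g ∘ p.2) a} := by
  rw [runLaw_map, Measure.map_apply (T.measurable_map_samples g) (T.measurableSet_takes f a)]
  rfl

theorem ae_usesAtMost_comp {μ : PMF I} {g : I → Cube d}
    (h : ∀ᵐ p ∂T.runLaw (μ.map g), T.UsesAtMost f p.1 p.2 M Q) :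
    ∀ᵐ p ∂T.indexLaw μ, T.UsesAtMost f p.1 (g ∘ p.2) M Q := by
  rw [runLaw_map] at h
  exact ae_of_ae_map (T.measurable_map_samples g).aemeasurable h

end Indices

end Algorithm

/-! ### The hard instances -/

theorem half_le_distToLip {C : Type*} [Fintype C] [Nonempty C] {d : ℕ} {f : Cube d → ℝ}
    {a : C × Bool → Cube d} (ha : ∀ c, (hammingDist (a (c, true)) (a (c, false)) : ℝ) <
      |f (a (c, true)) - f (a (c, false))|) :
    1 / 2 ≤ distToLip ((PMF.uniformOfFintype (C × Bool)).map a) f := by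
  classical
  refine le_iInf fun ⟨g, hg⟩ => ?_
  have hne (c : C) : ∃ b, f (a (c, b)) ≠ g (a (c, b)) := by
    by_contra! hc
    have hlip := hg (a (c, true)) (a (c, false))
    rw [← hc, ← hc, hypercube_dist] at hlip
    exact (ha c).not_ge hlip
  choose b hb using hne
  let wrong : Set (C × Bool) := a ⁻¹' {x | f x ≠ g x}
  have hcard : Fintype.card C ≤ Fintype.card wrong :=
    Fintype.card_le_of_injective (fun c => (⟨(c, b c), hb c⟩ : wrong))
      fun c c' hcc => congrArg (fun x : wrong => x.1.1) hcc
  let : MeasurableSpace (C × Bool) := ⊤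
  rw [PMF.toMeasure_map_apply _ _ _ measurable_from_top (Set.toFinite _).measurableSet,
    PMF.toMeasure_uniformOfFintype_apply _ MeasurableSpace.measurableSet_top]
  calc (1 / 2 : ℝ≥0∞) = Fintype.card C / Fintype.card (C × Bool) := by
        rw [Fintype.card_prod, Fintype.card_bool, Nat.cast_mul, Nat.cast_ofNat,
          ← ENNReal.mul_div_mul_left 1 2 (c := (Fintype.card C : ℝ≥0∞)) (by simp) (by simp),
          mul_one]
    _ ≤ Fintype.card wrong / Fintype.card (C × Bool) := by gcongr

section HardInstances

variable {C : Type*} {m n h : ℕ}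

/-- The positions, within their cells, of the low apexes `(c, true)` and of the high apexes
`(c, false)`: the two apexes of a cell differ exactly in the coordinates in `Y`. -/
def apexPos (u : C → Cube n) (Y : Finset (Fin n)) (x : C × Bool) : Cube n :=
  if x.2 then u x.1 else flipOn (u x.1) Y

/-- The apexes of the hard instances. The cell of `c : C` is the copy `{κ c} × {0,1}^n` of the
`n`-cube. -/
def apex (κ : C → Cube m) (u : C → Cube n) (Y : Finset (Fin n)) (x : C × Bool) : Cube (m + n) :=
  Fin.append (κ x.1) (apexPos u Y x)

/-- The function of the hard instance with low apex positions `u` and differences `Y`. -/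
noncomputable def hardFn [Fintype C] (h : ℕ) (κ : C → Cube m) (u : C → Cube n)
    (Y : Finset (Fin n)) : Cube (m + n) → ℝ :=
  coneFn h (fun c => apex κ u Y (c, true)) (fun c => apex κ u Y (c, false))
    Finset.univ Finset.univ

/-- The distribution of the hard instance with low apex positions `u` and differences `Y`. -/
noncomputable def hardDist [Fintype C] [Nonempty C] (κ : C → Cube m) (u : C → Cube n)
    (Y : Finset (Fin n)) : PMF (Cube (m + n)) :=
  (PMF.uniformOfFintype (C × Bool)).map (apex κ u Y)

/-- The positions of the apexes that are seen when each cell `c` shows its apex on the side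
`side c`. -/
def seenPos (side : C → Bool) (Y : Finset (Fin n)) (u : C → Cube n) (c : C) : Cube n :=
  apexPos u Y (c, side c)

/-- The function that has, in each cell `c`, only one cone, with apex at `v c` and pointing to the
side `side c`. -/
noncomputable def seenFn [Fintype C] (h : ℕ) (κ : C → Cube m) (side : C → Bool) (v : C → Cube n) :
    Cube (m + n) → ℝ :=
  coneFn h (fun c => Fin.append (κ c) (v c)) (fun c => Fin.append (κ c) (v c))
    {c | side c = true} {c | side c = false}

/-- The point `z` lies in the cone of a hidden apex, when the seen apexes have the positions `v`. -/
def Reveals (h : ℕ) (κ : C → Cube m) (v : C → Cube n) (Y : Finset (Fin n))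
    (z : Cube (m + n)) : Prop :=
  ∃ c, hammingDist z (Fin.append (κ c) (flipOn (v c) Y)) < h

variable {κ : C → Cube m} {u v : C → Cube n} {Y : Finset (Fin n)} {side : C → Bool}

theorem seenPos_seenPos (side : C → Bool) (Y : Finset (Fin n)) (u : C → Cube n) :
    seenPos side Y (seenPos side Y u) = u := by
  funext c
  cases hc : side c <;> simp [seenPos, apexPos, hc, flipOn_flipOn]

theorem apexPos_of_ne_side {c : C} {b : Bool} (hb : b ≠ side c) :
    apexPos u Y (c, b) = flipOn (seenPos side Y u c) Y := by
  obtain rfl := Bool.eq_not_of_ne hb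
  cases hc : side c <;> simp [seenPos, apexPos, hc, flipOn_flipOn]

theorem hammingDist_apex_apex (κ : C → Cube m) (u : C → Cube n) (Y : Finset (Fin n)) (c : C) :
    hammingDist (apex κ u Y (c, true)) (apex κ u Y (c, false)) = #Y := by
  simp [apex, apexPos, hammingDist_append, hammingDist_flipOn]

theorem le_hammingDist_apex {k : ℕ} (hκ : Pairwise fun c c' => k ≤ hammingDist (κ c) (κ c'))
    (hY : k ≤ #Y) (c c' : C) : k ≤ hammingDist (apex κ u Y (c, true)) (apex κ u Y (c', false)) := by
  rcases eq_or_ne c c' with rfl | hc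
  · rwa [hammingDist_apex_apex]
  · simp only [apex, hammingDist_append]
    exact (hκ hc).trans (Nat.le_add_right _ _)

theorem card_revealed_le (hκ : Pairwise fun c c' => 2 * h ≤ hammingDist (κ c) (κ c'))
    (s : Finset (Finset (Fin n))) (v : C → Cube n) (z : Cube (m + n))
    [DecidablePred fun Y => Reveals h κ v Y z] :
    #{Y ∈ s | Reveals h κ v Y z} ≤ hammingBallCard (Fin n) (h - 1) := by
  obtain ⟨x, y, rfl⟩ : ∃ x y, z = Fin.append x y := ⟨_, _, (Fin.append_castAdd_natAdd).symm⟩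
  by_cases hx : ∃ c, hammingDist x (κ c) < h
  · obtain ⟨c, hc⟩ := hx
    refine (Finset.card_le_card fun Y hY => ?_).trans (card_hammingDist_flipOn_le s y (v c) _)
    obtain ⟨hYs, c', hc'⟩ := Finset.mem_filter.1 hY
    rw [hammingDist_append] at hc'
    have hcell : c' = c := by
      by_contra hne
      have := hκ hne
      have := hammingDist_triangle_left (κ c') (κ c) x
      omega
    subst hcell
    exact Finset.mem_filter.2 ⟨hYs, by omega⟩
  · rw [Finset.filter_false_of_mem, Finset.card_empty]
    · exact Nat.zero_le _
    · rintro Y - ⟨c, hc⟩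
      rw [hammingDist_append] at hc
      exact hx ⟨c, by omega⟩

open Classical in
theorem card_exists_revealed_le (hκ : Pairwise fun c c' => 2 * h ≤ hammingDist (κ c) (κ c'))
    (s : Finset (Finset (Fin n))) (v : C → Cube n) (Z : Finset (Cube (m + n))) :
    #{Y ∈ s | ∃ z ∈ Z, Reveals h κ v Y z} ≤ #Z * hammingBallCard (Fin n) (h - 1) := by
  refine (Finset.card_le_card fun Y hY => ?_).trans
    (Finset.card_biUnion_le_card_mul Z (fun z => {Y ∈ s | Reveals h κ v Y z}) _
      fun z _ => card_revealed_le hκ s v z)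
  obtain ⟨hYs, z, hz, hzY⟩ := Finset.mem_filter.1 hY
  exact Finset.mem_biUnion.2 ⟨z, hz, Finset.mem_filter.2 ⟨hYs, hzY⟩⟩

variable [Fintype C]

theorem isLip_hardFn (hκ : Pairwise fun c c' => 2 * h ≤ hammingDist (κ c) (κ c'))
    (u : C → Cube n) (hY : 2 * h ≤ #Y) : IsLip (hardFn h κ u Y) :=
  isLip_coneFn fun c _ c' _ => le_hammingDist_apex hκ hY c c'

theorem half_le_distToLip_hardFn [Nonempty C]
    (hκ : Pairwise fun c c' => h ≤ hammingDist (κ c) (κ c')) (u : C → Cube n)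
    (hY : h ≤ #Y) (hY' : #Y < 2 * h) : 1 / 2 ≤ distToLip (hardDist κ u Y) (hardFn h κ u Y) := by
  have hdist := le_hammingDist_apex (u := u) hκ hY
  refine half_le_distToLip fun c => ?_
  have hlow : hardFn h κ u Y (apex κ u Y (c, true)) = 0 :=
    coneFn_low_apex (a := fun c => apex κ u Y (c, true)) (Finset.mem_univ c) fun c' _ => hdist c c'
  have hhigh : hardFn h κ u Y (apex κ u Y (c, false)) = 2 * h :=
    coneFn_high_apex (b := fun c => apex κ u Y (c, false)) (Finset.mem_univ c) fun c' _ =>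
      hammingDist_comm (apex κ u Y (c', true)) _ ▸ hdist c' c
  rw [hlow, hhigh, zero_sub, abs_neg, abs_of_nonneg (by positivity), hammingDist_apex_apex]
  exact_mod_cast hY'

theorem hardFn_eq_seenFn {z : Cube (m + n)} (hz : ¬ Reveals h κ (seenPos side Y u) Y z) :
    hardFn h κ u Y z = seenFn h κ side (seenPos side Y u) z := by
  have hfar {c : C} {b : Bool} (hb : b ≠ side c) : h ≤ hammingDist z (apex κ u Y (c, b)) := by
    rw [apex, apexPos_of_ne_side hb]
    exact not_lt.1 fun hlt => hz ⟨c, hlt⟩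
  have hbump (b : Bool) : bump h (fun c => apex κ u Y (c, b)) Finset.univ z =
      bump h (fun c => Fin.append (κ c) (seenPos side Y u c)) {c | side c = b} z := by
    rw [← bump_filter_eq (p := fun c => side c = b) fun c _ hc => hfar (Ne.symm hc)]
    refine bump_congr (fun c hc => ?_) z
    rw [apex, seenPos, (Finset.mem_filter.1 hc).2]
  rw [hardFn, coneFn, hbump, hbump]
  rfl

end HardInstances

/-! ### Comparison with the runs that only see one apex of each cell -/

theorem natCast_div_mul_le_div_add_div {x v s k b : ℕ} (hk : k ≠ 0) (hs : s ≠ 0)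
    (hx : x ≤ v * s + k * b) : (x / ((k * s : ℕ) : ℝ≥0∞)) ≤ v / k + b / s := by
  have hk' : (k : ℝ≥0∞) ≠ 0 := Nat.cast_ne_zero.2 hk
  have hs' : (s : ℝ≥0∞) ≠ 0 := Nat.cast_ne_zero.2 hs
  calc (x / ((k * s : ℕ) : ℝ≥0∞)) ≤ ((v * s + k * b : ℕ) : ℝ≥0∞) / ((k * s : ℕ) : ℝ≥0∞) := by
        gcongr
    _ = v / k + b / s := by
        push_cast
        rw [ENNReal.add_div, ENNReal.mul_div_mul_right _ _ hs' (ENNReal.natCast_ne_top s),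
          ENNReal.mul_div_mul_left _ _ hk' (ENNReal.natCast_ne_top k)]

namespace Algorithm

variable {C : Type*} [Fintype C] {m n h : ℕ} {κ : C → Cube m} (T : Algorithm.{u} (m + n))
  {ρ : T.Seed} {ω : ℕ → C × Bool} {M Q : ℕ} {side : C → Bool} {a : Action (m + n)}

theorem Takes.takes_seenFn {u : C → Cube n} {Y : Finset (Fin n)}
    (ha : T.Takes (hardFn h κ u Y) ρ (apex κ u Y ∘ ω) a)
    (hle : T.UsesAtMost (hardFn h κ u Y) ρ (apex κ u Y ∘ ω) M Q)
    (hside : ∀ j < M, side (ω j).1 = (ω j).2)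
    (hY : ∀ z ∈ T.firstQueries (seenFn h κ side (seenPos side Y u)) ρ
      (fun j => Fin.append (κ (ω j).1) (seenPos side Y u (ω j).1)) Q,
        ¬ Reveals h κ (seenPos side Y u) Y z) :
    T.Takes (seenFn h κ side (seenPos side Y u)) ρ
      (fun j => Fin.append (κ (ω j).1) (seenPos side Y u (ω j).1)) a := by
  refine ha.of_agree T hle (fun j hj => ?_) fun z hz => hardFn_eq_seenFn (hY z hz)
  simp only [Function.comp_apply, apex, seenPos, hside j hj]

variable [DecidableEq C]

open Classical in
/-- The positions `v` of the seen apexes for which the run that only sees these apexes takes the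
action `a`. -/
noncomputable def seenRuns (h : ℕ) (κ : C → Cube m) (ρ : T.Seed) (ω : ℕ → C × Bool)
    (side : C → Bool) (a : Action (m + n)) : Finset (C → Cube n) :=
  {v | T.Takes (seenFn h κ side v) ρ (fun j => Fin.append (κ (ω j).1) (v (ω j).1)) a}

open Classical in
/-- The hard instances with differences in `s` on which the run takes the action `a`. -/
noncomputable def hardRuns (h : ℕ) (κ : C → Cube m) (ρ : T.Seed) (ω : ℕ → C × Bool)
    (s : Finset (Finset (Fin n))) (a : Action (m + n)) : Finset ((C → Cube n) × Finset (Fin n)) :=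
  {q ∈ Finset.univ ×ˢ s | T.Takes (hardFn h κ q.1 q.2) ρ (apex κ q.1 q.2 ∘ ω) a}

theorem card_seenRuns_accept_add_card_seenRuns_reject_le :
    #(T.seenRuns (n := n) h κ ρ ω side .accept) + #(T.seenRuns h κ ρ ω side .reject) ≤
      Fintype.card (C → Cube n) := by
  classical
  rw [← Finset.card_union_of_disjoint]
  · exact Finset.card_le_univ _
  · exact Finset.disjoint_left.2 fun v hv hv' => T.not_takes_accept_and_reject
      ⟨(Finset.mem_filter.1 hv).2, (Finset.mem_filter.1 hv').2⟩

theorem card_hardRuns_le (hκ : Pairwise fun c c' => 2 * h ≤ hammingDist (κ c) (κ c'))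
    (hside : ∀ j < M, side (ω j).1 = (ω j).2) {s : Finset (Finset (Fin n))}
    (hle : ∀ u, ∀ Y ∈ s, T.UsesAtMost (hardFn h κ u Y) ρ (apex κ u Y ∘ ω) M Q) :
    #(T.hardRuns h κ ρ ω s a) ≤ #(T.seenRuns h κ ρ ω side a) * #s +
      Fintype.card (C → Cube n) * (Q * hammingBallCard (Fin n) (h - 1)) := by
  classical
  let queries (v : C → Cube n) : Finset (Cube (m + n)) :=
    T.firstQueries (seenFn h κ side v) ρ (fun j => Fin.append (κ (ω j).1) (v (ω j).1)) Q
  let revealing : Finset ((C → Cube n) × Finset (Fin n)) :=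
    {q ∈ Finset.univ ×ˢ s | ∃ z ∈ queries q.1, Reveals h κ q.1 q.2 z}
  have hrevealing : #revealing ≤
      Fintype.card (C → Cube n) * (Q * hammingBallCard (Fin n) (h - 1)) := by
    calc #revealing = ∑ v, #{Y ∈ s | ∃ z ∈ queries v, Reveals h κ v Y z} := by
          simp only [revealing, Finset.card_filter, Finset.sum_product]
      _ ≤ ∑ _v : C → Cube n, Q * hammingBallCard (Fin n) (h - 1) :=
          Finset.sum_le_sum fun v _ => (card_exists_revealed_le hκ s v (queries v)).trans
            (Nat.mul_le_mul_right _ (T.card_firstQueries_le _ _ _ Q))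
      _ = Fintype.card (C → Cube n) * (Q * hammingBallCard (Fin n) (h - 1)) := by
          rw [Finset.sum_const, Finset.card_univ, smul_eq_mul]
  have hmaps : ∀ q ∈ T.hardRuns h κ ρ ω s a,
      (seenPos side q.2 q.1, q.2) ∈ T.seenRuns h κ ρ ω side a ×ˢ s ∪ revealing := by
    rintro ⟨u, Y⟩ hq
    obtain ⟨hqs, hq⟩ := Finset.mem_filter.1 hq
    have hYs : Y ∈ s := (Finset.mem_product.1 hqs).2
    by_cases hrev : ∃ z ∈ queries (seenPos side Y u), Reveals h κ (seenPos side Y u) Y z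
    · exact Finset.mem_union_right _
        (Finset.mem_filter.2 ⟨Finset.mk_mem_product (Finset.mem_univ _) hYs, hrev⟩)
    · push Not at hrev
      exact Finset.mem_union_left _ (Finset.mk_mem_product (Finset.mem_filter.2
        ⟨Finset.mem_univ _, hq.takes_seenFn T (hle u Y hYs) hside hrev⟩) hYs)
  have hinj : Function.Injective fun q : (C → Cube n) × Finset (Fin n) =>
      (seenPos side q.2 q.1, q.2) :=
    Function.LeftInverse.injective (g := fun q => (seenPos side q.2 q.1, q.2)) fun q => by
      simp only [seenPos_seenPos]
  calc #(T.hardRuns h κ ρ ω s a) ≤ #(T.seenRuns h κ ρ ω side a ×ˢ s ∪ revealing) :=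
        Finset.card_le_card_of_injOn _ hmaps hinj.injOn
    _ ≤ #(T.seenRuns h κ ρ ω side a ×ˢ s) + #revealing := Finset.card_union_le _ _
    _ ≤ #(T.seenRuns h κ ρ ω side a) * #s +
        Fintype.card (C → Cube n) * (Q * hammingBallCard (Fin n) (h - 1)) := by
        rw [Finset.card_product]
        gcongr

theorem hardRuns_fraction_add_hardRuns_fraction_le
    (hκ : Pairwise fun c c' => 2 * h ≤ hammingDist (κ c) (κ c'))
    (hω : Set.InjOn (fun j => (ω j).1) (Set.Iio M)) {s s' : Finset (Finset (Fin n))}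
    (hs : s.Nonempty) (hs' : s'.Nonempty)
    (hle : ∀ u, ∀ Y ∈ s ∪ s', T.UsesAtMost (hardFn h κ u Y) ρ (apex κ u Y ∘ ω) M Q) :
    (#(T.hardRuns h κ ρ ω s .accept) / #((Finset.univ : Finset (C → Cube n)) ×ˢ s) : ℝ≥0∞) +
        #(T.hardRuns h κ ρ ω s' .reject) / #((Finset.univ : Finset (C → Cube n)) ×ˢ s') ≤
      1 + ((Q * hammingBallCard (Fin n) (h - 1) : ℕ) / #s +
        (Q * hammingBallCard (Fin n) (h - 1) : ℕ) / #s') := by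
  let N := Fintype.card (C → Cube n)
  let B := Q * hammingBallCard (Fin n) (h - 1)
  have : Nonempty ℕ := ⟨0⟩
  obtain ⟨side, hside⟩ : ∃ side : C → Bool, ∀ j < M, side (ω j).1 = (ω j).2 :=
    ⟨fun c => (ω (Function.invFunOn (fun j => (ω j).1) (Set.Iio M) c)).2, fun j hj =>
      congrArg (fun j => (ω j).2) (hω.leftInvOn_invFunOn hj)⟩
  have hN : N ≠ 0 := Fintype.card_ne_zero
  have hverdicts : (#(T.seenRuns (n := n) h κ ρ ω side .accept) / N : ℝ≥0∞) +
      #(T.seenRuns (n := n) h κ ρ ω side .reject) / N ≤ 1 := by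
    rw [← ENNReal.add_div]
    refine ENNReal.div_le_of_le_mul ?_
    rw [one_mul]
    exact_mod_cast T.card_seenRuns_accept_add_card_seenRuns_reject_le
  rw [Finset.card_product, Finset.card_product, Finset.card_univ]
  calc _ ≤ (#(T.seenRuns (n := n) h κ ρ ω side .accept) / N + B / #s : ℝ≥0∞) +
        (#(T.seenRuns (n := n) h κ ρ ω side .reject) / N + B / #s') := by
        gcongr
        · exact natCast_div_mul_le_div_add_div hN hs.card_pos.ne' (T.card_hardRuns_le hκ hside
            fun u Y hY => hle u Y (Finset.mem_union_left _ hY))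
        · exact natCast_div_mul_le_div_add_div hN hs'.card_pos.ne' (T.card_hardRuns_le hκ hside
            fun u Y hY => hle u Y (Finset.mem_union_right _ hY))
    _ = (#(T.seenRuns (n := n) h κ ρ ω side .accept) / N +
          #(T.seenRuns (n := n) h κ ρ ω side .reject) / N : ℝ≥0∞) + (B / #s + B / #s') :=
        add_add_add_comm _ _ _ _
    _ ≤ 1 + (B / #s + B / #s') := by gcongr

end Algorithm

/-! ### Random runs -/

section Probability

variable {Ω : Type*} [MeasurableSpace Ω] {μ : Measure Ω}

theorem le_lintegral_card_filter_div {ι : Type*} {s : Finset ι} (hs : s.Nonempty)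
    {E : ι → Ω → Prop} [∀ ω, DecidablePred fun i => E i ω]
    (hE : ∀ i ∈ s, MeasurableSet {ω | E i ω}) {α : ℝ≥0∞} (hα : ∀ i ∈ s, α ≤ μ {ω | E i ω}) :
    α ≤ ∫⁻ ω, #{i ∈ s | E i ω} / #s ∂μ := by
  classical
  have hcard (ω : Ω) : (#{i ∈ s | E i ω} : ℝ≥0∞) = ∑ i ∈ s, {ω | E i ω}.indicator 1 ω := by
    simp only [Set.indicator_apply, Set.mem_ofPred_eq, Pi.one_apply, Finset.sum_boole]
  simp only [div_eq_mul_inv, hcard]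
  rw [lintegral_mul_const' _ _ (ENNReal.inv_ne_top.2 (Nat.cast_ne_zero.2 hs.card_pos.ne')),
    lintegral_finsetSum' _ fun i hi => (measurable_one.indicator (hE i hi)).aemeasurable,
    ← div_eq_mul_inv, ENNReal.le_div_iff_mul_le (.inl (Nat.cast_ne_zero.2 hs.card_pos.ne'))
      (.inl (ENNReal.natCast_ne_top _)), mul_comm, ← nsmul_eq_mul]
  refine Finset.card_nsmul_le_sum _ _ _ fun i hi => ?_
  rw [lintegral_indicator_one (hE i hi)]
  exact hα i hi

theorem lintegral_add_lintegral_le_add_measure [IsProbabilityMeasure μ] {X Y : Ω → ℝ≥0∞}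
    {B : Set Ω} {K : ℝ≥0∞} (hX : ∀ ω, X ω ≤ 1) (hY : ∀ ω, Y ω ≤ 1)
    (hXY : ∀ᵐ ω ∂μ, ω ∉ B → X ω + Y ω ≤ K) :
    ∫⁻ ω, X ω ∂μ + ∫⁻ ω, Y ω ∂μ ≤ K + 2 * μ B := by
  calc ∫⁻ ω, X ω ∂μ + ∫⁻ ω, Y ω ∂μ ≤ ∫⁻ ω, X ω + Y ω ∂μ := le_lintegral_add _ _
    _ ≤ ∫⁻ ω, K + B.indicator (fun _ => 2) ω ∂μ := by
        refine lintegral_mono_ae ?_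
        filter_upwards [hXY] with ω hω
        by_cases hB : ω ∈ B
        · rw [Set.indicator_of_mem hB, ← one_add_one_eq_two]
          exact le_add_left (add_le_add (hX ω) (hY ω))
        · rw [Set.indicator_of_notMem hB, add_zero]
          exact hω hB
    _ = K + ∫⁻ ω, B.indicator (fun _ => 2) ω ∂μ := by
        rw [lintegral_add_left measurable_const, lintegral_const, measure_univ, mul_one]
    _ ≤ K + 2 * μ B := by
        gcongr
        exact lintegral_indicator_const_le B 2

variable {C : Type*} [Finite C] [IsProbabilityMeasure μ] {g : Ω → C} {p : ℝ≥0∞}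

theorem infinitePi_eq_le {ι : Type*} {i j : ι} (hij : i ≠ j)
    (hg : ∀ c, MeasurableSet (g ⁻¹' {c})) (hp : ∀ c, μ (g ⁻¹' {c}) ≤ p) :
    Measure.infinitePi (fun _ : ι => μ) {ω | g (ω i) = g (ω j)} ≤ p := by
  classical
  have := Fintype.ofFinite C
  have hcells : {ω : ι → Ω | g (ω i) = g (ω j)} =
      ⋃ c, (({i, j} : Finset ι) : Set ι).pi fun _ => g ⁻¹' {c} := by
    ext ω
    simp [eq_comm]
  calc Measure.infinitePi (fun _ : ι => μ) {ω | g (ω i) = g (ω j)}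
      ≤ ∑ c, Measure.infinitePi (fun _ : ι => μ)
          ((({i, j} : Finset ι) : Set ι).pi fun _ => g ⁻¹' {c}) := by
        rw [hcells]
        exact measure_iUnion_fintype_le _ _
    _ = ∑ c, μ (g ⁻¹' {c}) * μ (g ⁻¹' {c}) := by
        simp only [Measure.infinitePi_pi _ fun _ _ => hg _, Finset.prod_pair hij]
    _ ≤ ∑ c, p * μ (g ⁻¹' {c}) := by
        gcongr with c
        exact hp c
    _ = p := by
        rw [← Finset.mul_sum, sum_measure_preimage_singleton _ fun c _ => hg c, Finset.coe_univ,
          Set.preimage_univ, measure_univ, mul_one]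

theorem infinitePi_not_injOn_le (M : ℕ) (hg : ∀ c, MeasurableSet (g ⁻¹' {c}))
    (hp : ∀ c, μ (g ⁻¹' {c}) ≤ p) :
    Measure.infinitePi (fun _ : ℕ => μ) {ω | ¬ Set.InjOn (fun j => g (ω j)) (Set.Iio M)} ≤
      M ^ 2 * p := by
  have hsub : {ω : ℕ → Ω | ¬ Set.InjOn (fun j => g (ω j)) (Set.Iio M)} ⊆
      ⋃ q ∈ (Finset.range M).offDiag, {ω | g (ω q.1) = g (ω q.2)} := by
    intro ω hω
    simp only [Set.InjOn, Set.mem_ofPred_eq, Set.mem_Iio] at hω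
    push Not at hω
    obtain ⟨i, hi, j, hj, hij, hne⟩ := hω
    exact Set.mem_biUnion (x := (i, j)) (by simp [hi, hj, hne]) hij
  calc Measure.infinitePi (fun _ : ℕ => μ) {ω | ¬ Set.InjOn (fun j => g (ω j)) (Set.Iio M)}
      ≤ ∑ q ∈ (Finset.range M).offDiag,
          Measure.infinitePi (fun _ : ℕ => μ) {ω | g (ω q.1) = g (ω q.2)} :=
        (measure_mono hsub).trans (measure_biUnion_finset_le _ _)
    _ ≤ ∑ _q ∈ (Finset.range M).offDiag, p :=
        Finset.sum_le_sum fun q hq => infinitePi_eq_le (Finset.mem_offDiag.1 hq).2.2 hg hp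
    _ ≤ M ^ 2 * p := by
        rw [Finset.sum_const, nsmul_eq_mul, Finset.offDiag_card, Finset.card_range]
        gcongr
        rw [sq]
        exact_mod_cast Nat.sub_le _ _

end Probability

theorem toMeasure_uniformOfFintype_fst {α β : Type*} [Fintype α] [Nonempty α] [Fintype β]
    [Nonempty β] [MeasurableSpace α] [MeasurableSpace β] [DiscreteMeasurableSpace (α × β)]
    (a : α) : (PMF.uniformOfFintype (α × β)).toMeasure (Prod.fst ⁻¹' {a}) =
      (Fintype.card α : ℝ≥0∞)⁻¹ := by
  have hβ : (Fintype.card β : ℝ≥0∞) ≠ 0 := Nat.cast_ne_zero.2 Fintype.card_ne_zero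
  rw [← Set.prod_univ, PMF.toMeasure_uniformOfFintype_apply _ .of_discrete,
    ← Nat.card_eq_fintype_card, Nat.card_coe_set_eq, Set.ncard_prod, Set.ncard_singleton,
    Set.ncard_univ, Nat.card_eq_fintype_card, Fintype.card_prod, Nat.cast_mul, Nat.cast_mul,
    ENNReal.mul_div_mul_right _ _ hβ (ENNReal.natCast_ne_top _), Nat.cast_one, one_div]

namespace Algorithm

variable {C : Type*} [Fintype C] [Nonempty C] {m n h : ℕ} {κ : C → Cube m}
  (T : Algorithm.{u} (m + n)) {M Q : ℕ}

theorem indexLaw_not_injOn_le [MeasurableSpace C] [DiscreteMeasurableSpace C] (M : ℕ) :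
    T.indexLaw (PMF.uniformOfFintype (C × Bool))
      {p | ¬ Set.InjOn (fun j => (p.2 j).1) (Set.Iio M)} ≤ M ^ 2 / Fintype.card C := by
  calc _ = T.indexLaw (PMF.uniformOfFintype (C × Bool))
        (Set.univ ×ˢ {ω | ¬ Set.InjOn (fun j => (ω j).1) (Set.Iio M)}) := by
        rw [Set.univ_prod]
        rfl
    _ ≤ M ^ 2 / Fintype.card C := by
        rw [indexLaw, Measure.prod_prod, measure_univ, one_mul, div_eq_mul_inv]
        exact infinitePi_not_injOn_le M (fun c => .of_discrete) fun c =>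
          (toMeasure_uniformOfFintype_fst c).le

theorem le_lintegral_hardRuns_fraction [DecidableEq C] [MeasurableSpace C]
    [DiscreteMeasurableSpace C] {s : Finset (Finset (Fin n))} (hs : s.Nonempty)
    {a : Action (m + n)} {α : ℝ≥0∞}
    (hα : ∀ u, ∀ Y ∈ s, α ≤ T.runLaw (hardDist κ u Y) {p | T.Takes (hardFn h κ u Y) p.1 p.2 a}) :
    α ≤ ∫⁻ p, #(T.hardRuns h κ p.1 p.2 s a) / #((Finset.univ : Finset (C → Cube n)) ×ˢ s)
      ∂T.indexLaw (PMF.uniformOfFintype (C × Bool)) := by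
  classical
  simp only [hardRuns]
  exact le_lintegral_card_filter_div (Finset.univ_nonempty.product hs)
    (fun q _ => T.measurableSet_takes_comp _ (apex κ q.1 q.2) a) fun q hq =>
      (hα q.1 q.2 (Finset.mem_product.1 hq).2).trans_eq (T.runLaw_map_takes _ _ _ a)

theorem add_le_of_ae_usesAtMost (hκ : Pairwise fun c c' => 2 * h ≤ hammingDist (κ c) (κ c'))
    {s s' : Finset (Finset (Fin n))} (hs : s.Nonempty) (hs' : s'.Nonempty)
    (hle : ∀ u, ∀ Y ∈ s ∪ s', ∀ᵐ p ∂T.runLaw (hardDist κ u Y),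
      T.UsesAtMost (hardFn h κ u Y) p.1 p.2 M Q) {α β : ℝ≥0∞}
    (hα : ∀ u, ∀ Y ∈ s, α ≤ T.acceptProb (hardFn h κ u Y) (hardDist κ u Y))
    (hβ : ∀ u, ∀ Y ∈ s', β ≤ T.rejectProb (hardFn h κ u Y) (hardDist κ u Y)) :
    α + β ≤ 1 + ((Q * hammingBallCard (Fin n) (h - 1) : ℕ) / #s +
        (Q * hammingBallCard (Fin n) (h - 1) : ℕ) / #s') + 2 * (M ^ 2 / Fintype.card C) := by
  classical
  let : MeasurableSpace C := ⊤
  have : DiscreteMeasurableSpace C := ⟨fun _ => trivial⟩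
  let P := T.indexLaw (PMF.uniformOfFintype (C × Bool))
  let fraction (s : Finset (Finset (Fin n))) (a : Action (m + n)) (p : T.Seed × (ℕ → C × Bool)) :
      ℝ≥0∞ := #(T.hardRuns h κ p.1 p.2 s a) / #((Finset.univ : Finset (C → Cube n)) ×ˢ s)
  have hfraction_le_one (s : Finset (Finset (Fin n))) (a : Action (m + n))
      (p : T.Seed × (ℕ → C × Bool)) : fraction s a p ≤ 1 :=
    ENNReal.div_le_of_le_mul (by
      rw [one_mul]
      exact Nat.cast_le.2 (Finset.card_filter_le _ _))
  have hbounded : ∀ᵐ p ∂P, ∀ u, ∀ Y ∈ s ∪ s',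
      T.UsesAtMost (hardFn h κ u Y) p.1 (apex κ u Y ∘ p.2) M Q := by
    simp only [ae_all_iff, Filter.eventually_all_finset]
    exact fun u Y hY => T.ae_usesAtMost_comp (hle u Y hY)
  calc α + β ≤ ∫⁻ p, fraction s .accept p ∂P + ∫⁻ p, fraction s' .reject p ∂P :=
        add_le_add (T.le_lintegral_hardRuns_fraction hs hα)
          (T.le_lintegral_hardRuns_fraction hs' hβ)
    _ ≤ _ := lintegral_add_lintegral_le_add_measure (hfraction_le_one s _) (hfraction_le_one s' _)
        (hbounded.mono fun p hp hinj =>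
          T.hardRuns_fraction_add_hardRuns_fraction_le hκ (not_not.1 hinj) hs hs' hp)
    _ ≤ _ := by
        gcongr
        exact T.indexLaw_not_injOn_le M

theorem exists_not_ae_usesAtMost (hh : 0 < h)
    (hκ : Pairwise fun c c' => 2 * h ≤ hammingDist (κ c) (κ c'))
    (hT : T.IsDistributionFreeLipTester ((2 * h : ℕ) : ℝ) (1 / 2))
    (hM : 24 * M ^ 2 ≤ Fintype.card C)
    (hQ : ∀ k ∈ Set.Icc (2 * h - 1) (2 * h),
      24 * (Q * hammingBallCard (Fin n) (h - 1)) ≤ n.choose k)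
    (hn : 2 * h ≤ n) :
    ∃ u Y, ¬ ∀ᵐ p ∂T.runLaw (hardDist κ u Y), T.UsesAtMost (hardFn h κ u Y) p.1 p.2 M Q := by
  by_contra! hle
  let s (k : ℕ) : Finset (Finset (Fin n)) := Finset.univ.powersetCard k
  have hs {k : ℕ} (hk : k ≤ n) : (s k).Nonempty := by simpa [s, Finset.powersetCard_nonempty]
  have hcard (k : ℕ) : #(s k) = n.choose k := by simp [s]
  have hsmall {a b : ℕ} (hab : 24 * a ≤ b) : (a / b : ℝ≥0∞) ≤ 1 / 24 := by
    refine ENNReal.div_le_of_le_mul ?_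
    rw [one_div, mul_comm, ← div_eq_mul_inv, ENNReal.le_div_iff_mul_le (by simp) (by simp),
      mul_comm]
    exact_mod_cast hab
  have hsum := T.add_le_of_ae_usesAtMost (s := s (2 * h)) (s' := s (2 * h - 1)) hκ (hs hn)
    (hs (by omega)) (fun u Y _ => hle u Y)
    (fun u Y hY => (hT _ _ coneFn_mem_Icc).1
      (isLip_hardFn hκ u (Finset.mem_powersetCard.1 hY).2.ge))
    fun u Y hY => (hT _ _ coneFn_mem_Icc).2 (half_le_distToLip_hardFn
      (hκ.mono fun c c' hcc => by omega) u
      (by have := (Finset.mem_powersetCard.1 hY).2; omega)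
      (by have := (Finset.mem_powersetCard.1 hY).2; omega))
  rw [hcard, hcard] at hsum
  have hcollision : (M ^ 2 / Fintype.card C : ℝ≥0∞) ≤ 1 / 24 := mod_cast hsmall hM
  have hlt : (1 + (1 / 24 + 1 / 24) + 2 * (1 / 24) : ℝ≥0∞) < 2 / 3 + 2 / 3 := by
    rw [← ENNReal.toReal_lt_toReal (by finiteness) (by finiteness),
      ENNReal.toReal_add (a := 2 / 3) (by finiteness) (by finiteness)]
    norm_num [ENNReal.toReal_add, ENNReal.add_eq_top, ENNReal.mul_eq_top]
  exact hlt.not_ge (hsum.trans (add_le_add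
    (add_le_add le_rfl (add_le_add (hsmall (hQ _ (by simp))) (hsmall (hQ _ (by simp)))))
    (mul_le_mul_right hcollision 2)))

end Algorithm

/-! ### Numerical estimates -/

theorem hammingBallCard_le_exp_mul_pow (ι : Type*) [Fintype ι] (m : ℕ) {t : ℝ} (ht : 1 ≤ t) :
    hammingBallCard ι m ≤ Real.exp (Fintype.card ι / t) * t ^ m := by
  have htpos : 0 < t := by linarith
  have hball := hammingBallCard_mul_pow_le (ι := ι) m (inv_pos.2 htpos).le
    (inv_le_one_of_one_le₀ ht)
  rw [inv_pow, ← div_eq_mul_inv, div_le_iff₀ (by positivity)] at hball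
  refine hball.trans (mul_le_mul_of_nonneg_right ?_ (by positivity))
  calc (1 + t⁻¹) ^ Fintype.card ι ≤ Real.exp t⁻¹ ^ Fintype.card ι := by
        gcongr
        linarith [Real.add_one_le_exp t⁻¹]
    _ = Real.exp (Fintype.card ι / t) := by rw [← Real.exp_nat_mul, div_eq_mul_inv]

theorem div_pow_le_choose {k n : ℕ} (hk : k ≤ n) : ((n : ℝ) / k) ^ k ≤ n.choose k := by
  induction k generalizing n with
  | zero => simp
  | succ k ih =>
    obtain ⟨n, rfl⟩ : ∃ m, n = m + 1 := ⟨n - 1, by omega⟩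
    have hkn : k ≤ n := by omega
    have habsorb : ((n + 1 : ℕ).choose (k + 1) : ℝ) =
        ((n + 1 : ℕ) : ℝ) / (k + 1 : ℕ) * n.choose k := by
      rw [div_mul_eq_mul_div, eq_div_iff (by positivity)]
      exact_mod_cast (Nat.add_one_mul_choose_eq n k).symm
    have hratio : (((n + 1 : ℕ) : ℝ) / (k + 1 : ℕ)) ^ k ≤ ((n : ℝ) / k) ^ k := by
      rcases Nat.eq_zero_or_pos k with rfl | hk0
      · simp
      · gcongr ?_ ^ k
        rw [div_le_div_iff₀ (by positivity) (by positivity)]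
        exact_mod_cast (by nlinarith : (n + 1) * k ≤ n * (k + 1))
    rw [habsorb, pow_succ']
    gcongr
    exact hratio.trans (ih hkn)

theorem div_pow_le_choose_of_le {j k r n : ℕ} (hjk : j ≤ k) (hkr : k ≤ r) (hrn : r ≤ n) :
    ((n : ℝ) / r) ^ j ≤ n.choose k := by
  rcases Nat.eq_zero_or_pos k with rfl | hk
  · simp [Nat.le_zero.1 hjk]
  · have hr : (0 : ℝ) < r := mod_cast hk.trans_le hkr
    calc ((n : ℝ) / r) ^ j ≤ (n / r) ^ k :=
          pow_le_pow_right₀ ((one_le_div hr).2 (mod_cast hrn)) hjk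
      _ ≤ (n / k) ^ k := by gcongr
      _ ≤ n.choose k := div_pow_le_choose (hkr.trans hrn)

theorem rpow_le_sqrt_pow {t y : ℝ} (ht : 0 ≤ t) (hy : 0 ≤ y) (hyt : y ≤ t ^ 4) (h : ℕ) :
    y ^ ((1 / 16 : ℝ) * (2 * h : ℕ)) ≤ √t ^ h := by
  calc y ^ ((1 / 16 : ℝ) * (2 * h : ℕ)) ≤ (t ^ 4) ^ ((1 / 16 : ℝ) * (2 * h : ℕ)) := by gcongr
    _ = √t ^ h := by
        rw [Real.sqrt_eq_rpow, ← Real.rpow_natCast, ← Real.rpow_natCast, ← Real.rpow_mul ht,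
          ← Real.rpow_mul ht]
        congr 1
        push_cast
        ring

theorem mul_sq_floor_two_rpow_le {m r d N : ℕ} (hr : 1 ≤ r) (hd : 65536 * r ≤ d)
    (hm : d ≤ 2 * m + 1) (hN : 2 ^ m ≤ N * hammingBallCard (Fin m) (r - 1)) :
    24 * ⌊(2 : ℝ) ^ ((1 / 16 : ℝ) * d)⌋₊ ^ 2 ≤ N := by
  have hball : (hammingBallCard (Fin m) (r - 1) : ℝ) ≤ 2 ^ (m / 2 + 2 * r : ℝ) := by
    have hexp : Real.exp (m / 4) ≤ 2 ^ (m / 2 : ℝ) := by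
      rw [Real.rpow_def_of_pos two_pos, Real.exp_le_exp]
      nlinarith [Real.log_two_gt_d9, m.cast_nonneg (α := ℝ)]
    calc (hammingBallCard (Fin m) (r - 1) : ℝ) ≤ Real.exp (m / 4) * 4 ^ (r - 1) := by
          simpa using hammingBallCard_le_exp_mul_pow (Fin m) (r - 1) (t := 4) (by norm_num)
      _ ≤ 2 ^ (m / 2 : ℝ) * 4 ^ r := by
          gcongr
          · norm_num
          · omega
      _ = 2 ^ (m / 2 + 2 * r : ℝ) := by
          rw [Real.rpow_add two_pos, Real.rpow_mul two_pos.le, Real.rpow_natCast]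
          norm_num
  have hexponents : 5 + (1 / 16 : ℝ) * d * 2 + (m / 2 + 2 * r) ≤ m := by
    have hr' : (1 : ℝ) ≤ r := mod_cast hr
    have hd' : 65536 * (r : ℝ) ≤ d := mod_cast hd
    have hm' : (d : ℝ) ≤ 2 * m + 1 := mod_cast hm
    linarith
  suffices hreal : (24 : ℝ) * ⌊(2 : ℝ) ^ ((1 / 16 : ℝ) * d)⌋₊ ^ 2 ≤ N by exact_mod_cast hreal
  refine le_of_mul_le_mul_right (a := (2 : ℝ) ^ (m / 2 + 2 * r : ℝ)) ?_ (by positivity)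
  calc (24 : ℝ) * ⌊(2 : ℝ) ^ ((1 / 16 : ℝ) * d)⌋₊ ^ 2 * 2 ^ (m / 2 + 2 * r : ℝ)
      ≤ 2 ^ (5 : ℝ) * (2 ^ ((1 / 16 : ℝ) * d)) ^ 2 * 2 ^ (m / 2 + 2 * r : ℝ) := by
        gcongr
        · norm_num
        · exact Nat.floor_le (by positivity)
    _ = 2 ^ (5 + (1 / 16 : ℝ) * d * 2 + (m / 2 + 2 * r)) := by
        rw [Real.rpow_add two_pos (5 + _), Real.rpow_add two_pos 5, Real.rpow_mul two_pos.le _ 2,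
          Real.rpow_two]
    _ ≤ 2 ^ (m : ℝ) := Real.rpow_le_rpow_of_exponent_le one_le_two hexponents
    _ ≤ N * hammingBallCard (Fin m) (r - 1) := by
        rw [Real.rpow_natCast]
        exact_mod_cast hN
    _ ≤ N * 2 ^ (m / 2 + 2 * r : ℝ) := by gcongr

theorem hammingBallCard_le_nine_pow_mul_pow {n h : ℕ} (m : ℕ) (hh : 0 < h) (hn : 2 * h ≤ n) :
    (hammingBallCard (Fin n) m : ℝ) ≤ 9 ^ h * (n / (2 * h : ℕ)) ^ m := by
  have hr : (0 : ℝ) < (2 * h : ℕ) := mod_cast (by omega : 0 < 2 * h)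
  have hexp : Real.exp (n / (n / (2 * h : ℕ))) ≤ 9 ^ h := by
    rw [div_div_cancel₀ (mod_cast (by omega : n ≠ 0)), ← mul_one ((2 * h : ℕ) : ℝ),
      Real.exp_nat_mul, pow_mul]
    gcongr
    nlinarith [Real.exp_one_lt_three, Real.exp_pos 1]
  have hball := hammingBallCard_le_exp_mul_pow (Fin n) m (t := n / (2 * h : ℕ))
    ((one_le_div hr).2 (mod_cast hn))
  rw [Fintype.card_fin] at hball
  exact hball.trans (by gcongr)

theorem floor_rpow_mul_hammingBallCard_le_choose {n h d k : ℕ} (hh : 2 ≤ h)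
    (hn : 10000 * (2 * h) ≤ n) (hd : d ≤ 2 * n) (hk : k ∈ Set.Icc (2 * h - 1) (2 * h)) :
    24 * (⌊((d : ℝ) / (2 * h : ℕ)) ^ ((1 / 16 : ℝ) * (2 * h : ℕ))⌋₊ *
      hammingBallCard (Fin n) (h - 1)) ≤ n.choose k := by
  obtain ⟨hk, hk'⟩ := hk
  have hr : (0 : ℝ) < (2 * h : ℕ) := by exact_mod_cast (by omega : 0 < 2 * h)
  let t : ℝ := n / (2 * h : ℕ)
  have ht : 10000 ≤ t := by
    rw [le_div_iff₀ hr]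
    exact_mod_cast hn
  have htpos : 0 < t := by linarith
  have hsqrt : 100 ≤ √t := Real.le_sqrt_of_sq_le (by linarith)
  have hball : (hammingBallCard (Fin n) (h - 1) : ℝ) ≤ 9 ^ h * t ^ (h - 1) :=
    hammingBallCard_le_nine_pow_mul_pow (h - 1) (by omega) (by omega)
  have hfloor : (⌊((d : ℝ) / (2 * h : ℕ)) ^ ((1 / 16 : ℝ) * (2 * h : ℕ))⌋₊ : ℝ) ≤ √t ^ h := by
    have hdt : (d : ℝ) / (2 * h : ℕ) ≤ t ^ 4 := by
      have hdn : (d : ℝ) ≤ 2 * n := mod_cast hd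
      calc (d : ℝ) / (2 * h : ℕ) ≤ 2 * t := by
            rw [← mul_div_assoc]
            gcongr
        _ ≤ t ^ 2 := by nlinarith
        _ ≤ t ^ 4 := pow_le_pow_right₀ (by linarith) (by norm_num)
    exact (Nat.floor_le (by positivity)).trans (rpow_le_sqrt_pow htpos.le (by positivity) hdt h)
  have hconst : 24 * 9 ^ h ≤ √t ^ h := by
    calc (24 * 9 ^ h : ℝ) ≤ 5 ^ h * 9 ^ h := by
          gcongr
          exact le_trans (by norm_num) (pow_le_pow_right₀ (by norm_num) hh : (5 : ℝ) ^ 2 ≤ 5 ^ h)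
      _ = 45 ^ h := by rw [← mul_pow]; norm_num
      _ ≤ √t ^ h := by
          gcongr
          linarith
  suffices hreal : 24 * ((⌊((d : ℝ) / (2 * h : ℕ)) ^ ((1 / 16 : ℝ) * (2 * h : ℕ))⌋₊ : ℝ) *
      hammingBallCard (Fin n) (h - 1)) ≤ n.choose k by exact_mod_cast hreal
  calc _ ≤ 24 * (√t ^ h * (9 ^ h * t ^ (h - 1))) := by gcongr
    _ = 24 * 9 ^ h * √t ^ h * t ^ (h - 1) := by ring
    _ ≤ √t ^ h * √t ^ h * t ^ (h - 1) := by gcongr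
    _ = t ^ (2 * h - 1) := by
        rw [← mul_pow, Real.mul_self_sqrt htpos.le, ← pow_add]
        congr 1
        omega
    _ ≤ n.choose k := div_pow_le_choose_of_le hk hk' (by omega)

end LipschitzTesting

theorem mainTheorem4 :
    ∃ c : ℝ, 0 < c ∧ ∃ d₀ : ℕ, ∀ d : ℕ, d₀ ≤ d →
      ∀ r : ℕ, Even r → 4 ≤ r → (r : ℝ) ≤ (2 : ℝ) ^ (-16 : ℤ) * (d : ℝ) →
        ∀ T : LipschitzTesting.Algorithm.{u} d,
          T.IsDistributionFreeLipTester (r : ℝ) (1 / 2) →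
            ∃ (f : LipschitzTesting.Cube d → ℝ) (D : PMF (LipschitzTesting.Cube d)),
              (∀ x, f x ∈ Set.Icc (0 : ℝ) (r : ℝ)) ∧
              (ENNReal.ofReal ((2 : ℝ) ^ (c * (d : ℝ))) ≤ (T.sampleComplexity f D : ENNReal) ∨
                ENNReal.ofReal (((d : ℝ) / (r : ℝ)) ^ (c * (r : ℝ))) ≤
                  (T.queryComplexity f D : ENNReal)) := by
  open LipschitzTesting in
  refine ⟨1 / 16, by norm_num, 0, fun d _ r hev hr4 hrd T hT => ?_⟩
  obtain ⟨h, rfl⟩ := hev.two_dvd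
  have hd : 65536 * (2 * h) ≤ d := by
    have : (65536 : ℝ) * (2 * h : ℕ) ≤ d := by
      norm_num [zpow_neg] at hrd ⊢
      linarith
    exact_mod_cast this
  obtain ⟨m, n, rfl, hmn, hnm⟩ : ∃ m n, d = m + n ∧ m ≤ n ∧ n ≤ m + 1 :=
    ⟨d / 2, d - d / 2, by omega, by omega, by omega⟩
  obtain ⟨C, hC, hCcard⟩ := exists_code (Fin m) (2 * h)
  rw [Fintype.card_fin] at hCcard
  have : Nonempty C :=
    (Finset.card_pos.1 (Nat.pos_of_mul_pos_right (hCcard.trans_lt' (by positivity)))).to_subtype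
  obtain ⟨u, Y, hrun⟩ := T.exists_not_ae_usesAtMost (κ := fun c : C => c.1) (by omega)
    (fun c c' hcc => hC c.2 c'.2 (Subtype.coe_injective.ne hcc)) hT
    ((mul_sq_floor_two_rpow_le (by omega) hd (by omega) hCcard).trans_eq (Fintype.card_coe C).symm)
    (fun k hk => floor_rpow_mul_hammingBallCard_le_choose (by omega) (by omega)
      (d := m + n) (by omega) hk) (by omega)
  exact ⟨hardFn h (fun c : C => c.1) u Y, hardDist (fun c : C => c.1) u Y,
    fun x => coneFn_mem_Icc _, T.le_sampleComplexity_or_le_queryComplexity hrun⟩
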